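/- Let $k\ge 1$. A configuration is a finitely supported sequence ${\bf a}=(a_i)_{i\in{\bf Z}}$ of non-negative integers. For $0\le l\le k$ let $C^{(k,l)}$ be the set of configurations such that, for all $i$, $$a_i+a_{i+1}+a_{i+2}\le k,\qquad S[i,{\bf a}]:=a_i+a_{i+1}\le l,\qquad L[i,{\bf a}]:=a_{i-1}+2a_i+2a_{i+1}+a_{i+2}\le k+l .$$ Let $A_{l,l'}=2\min(l,l')+\max(l+l'-k,0)$. *Moves.* Let $l\ge1$ and ${\bf a}\in C^{(k,l)}\setminus C^{(k,l-1)}$. Then $S[i,{\bf a}]=l$ or $L[i,{\bf a}]=k+l$ for some $i$; let $i_1$ be the largest and $j_1$ the smallest such $i$. The right move $M_+$ replaces $(a_{i_1},a_{i_1+1})$ by $(a_{i_1}-1,a_{i_1+1}+1)$, and the left move $M_-$ replaces $(a_{j_1},a_{j_1+1})$ by $(a_{j_1}+1,a_{j_1+1}-1)$. *Particle content and rigging.* To a configuration ${\bf a}\in C^{(k,k)}$ one associates $\iota({\bf a})=(\lambda,\rho)$ with $\lambda=(\lambda_1,\ldots,\lambda_n)$ (the particle content) and $\rho=(\rho_1,\ldots,\rho_n)\in{\bf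 Z}^n$ (the rigging) inductively. If ${\bf a}={\bf 0}$, then $n=0$. Otherwise let $l\geq 1$ be such that ${\bf a}\in C^{(k,l)}\setminus C^{(k,l-1)}$, and take $t\ge0$ such that ${\bf b}=M_+^t{\bf a}$ contains a free particle of weight $l$ at some position $i$, that is, $b_i+b_{i+1}=l$, $b_i\ne0$ and $b_j=0$ for all $j\ge i+2$. Let $(\lambda_2,\ldots,\lambda_n)$ and $(\rho_2,\ldots,\rho_n)$ be the particle content and the rigging of the configuration obtained from ${\bf b}$ by replacing $b_i,b_{i+1}$ by $0$, and set $$\lambda_1=l,\qquad \rho_1=ib_i+(i+1)b_{i+1}-t-\sum_{j=2}^nA_{l,\lambda_j}.$$ *Passage of a heavy particle.* Let $1\le l'<l\le k$ and ${\bf a}\in C^{(k,l')}$. For $j_1$ sufficiently large let ${\bf a}[j_1]\in C^{(k,l)}$ be obtained from ${\bf a}$ by putting $l$ at the column $j_1$. The configuration ${\bf a}'=P_l{\bf a}$ is defined by the requirement that, for all sufficiently large $j_1$ and all $t$ sufficiently large depending on $j_1$, there are integers $j_2$ and $c$ with $1\le c\le l$ such that $a'_i=0$ for $i\le j_2+1$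 and $$(M_-^t{\bf a}[j_1])_i=\begin{cases}0&\text{if }i<j_2,\\ c&\text{if }i=j_2,\\ l-c&\text{if }i=j_2+1,\\ a'_i&\text{if }i>j_2+1.\end{cases}$$ **Proposition.** Let $1\le l'<l\le k$ and ${\bf a}\in C^{(k,l')}$. Then there is exactly one such configuration ${\bf a}'=P_l{\bf a}$, the pair $\iota({\bf a})=(\lambda,\rho)$ is well defined, and 1. $P_l{\bf a}\in C^{(k,l')}$; 2. $\iota(P_l{\bf a})$ is well defined, and if $\iota(P_l{\bf a})=(\mu,\rho')$, then $\mu=\lambda$ and $\rho'_i=\rho_i+A_{l,\lambda_i}$ for all $i$. -/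

import Mathlib

namespace K3

/-- A finite configuration: a finitely supported sequence of non-negative integers
indexed by the integers. -/
abbrev Config := ℤ →₀ ℕ

/-- `S[j, a] = a_j + a_{j+1}`. -/
def S (a : Config) (j : ℤ) : ℕ := a j + a (j + 1)

/-- `L[j, a] = a_{j-1} + 2 a_j + 2 a_{j+1} + a_{j+2}`. -/
def L (a : Config) (j : ℤ) : ℕ := a (j - 1) + 2 * a j + 2 * a (j + 1) + a (j + 2)

/-- The set `C^{(k,l)}` of finite `(k,3)`-admissible configurations of maximal weight
at most `l`. -/
def C (k l : ℕ) : Set Config :=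
  {a | (∀ i, a i + a (i + 1) + a (i + 2) ≤ k) ∧ (∀ i, S a i ≤ l) ∧ (∀ i, L a i ≤ k + l)}

/-- The indices at which a configuration of maximal weight `l` attains one of its bounds. -/
def tight (k l : ℕ) (a : Config) : Set ℤ := {i | S a i = l ∨ L a i = k + l}

/-- The highest position of the weight `l` particles of `a` (the maximum of a non-empty
finite set when `l ≥ 1` and `a` lies in `C^{(k,l)}` but not in `C^{(k,l-1)}`). -/
noncomputable def highest (k l : ℕ) (a : Config) : ℤ := sSup (tight k l a)

/-- The lowest position of the weight `l` particles of `a`. -/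
noncomputable def lowest (k l : ℕ) (a : Config) : ℤ := sInf (tight k l a)

/-- The right move `M_+` on the configurations in `C^{(k,l)}` but not in `C^{(k,l-1)}`:
`(a_i, a_{i+1})` becomes `(a_i - 1, a_{i+1} + 1)` at the highest position `i`. -/
noncomputable def moveRight (k l : ℕ) (a : Config) : Config :=
  (a.update (highest k l a) (a (highest k l a) - 1)).update
    (highest k l a + 1) (a (highest k l a + 1) + 1)

/-- The left move `M_-`: `(a_j, a_{j+1})` becomes `(a_j + 1, a_{j+1} - 1)` at the lowest
position `j`. -/
noncomputable def moveLeft (k l : ℕ) (a : Config) : Config :=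
  (a.update (lowest k l a) (a (lowest k l a) + 1)).update
    (lowest k l a + 1) (a (lowest k l a + 1) - 1)

/-- The two-body phase shift `A_{l,l'} = 2 min(l,l') + (l + l' - k)_+`; the truncated
subtraction of natural numbers is the positive part. -/
def A (k l l' : ℕ) : ℕ := 2 * min l l' + (l + l' - k)

/-- `b` contains a free particle of weight `l` at the position `i`. -/
def IsFreeAt (l : ℕ) (b : Config) (i : ℤ) : Prop :=
  S b i = l ∧ b i ≠ 0 ∧ ∀ j, i + 2 ≤ j → b j = 0

/-- `HasRigging k a Λ` is the graph of the map `ι`: the list `Λ` of the pairs `(λ_i, ρ_i)`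
consists of the particle content `λ` of `a` and its rigging `ρ`. If `a` has maximal weight
exactly `l ≥ 1`, one applies `t` right moves after which a free particle of weight `l` at
a position `i`, of energy `d`, has split off, and continues with the configuration left
after removing it. Then `λ_1 = l` and `ρ_1 = (d - t) - ∑_{j ≥ 2} A_{l,λ_j}`. -/
inductive HasRigging (k : ℕ) : Config → List (ℕ × ℤ) → Prop
  | zero : HasRigging k 0 []
  | step (l : ℕ) (a b : Config) (t : ℕ) (i : ℤ) (Λ : List (ℕ × ℤ))
      (hl : 1 ≤ l) (ha : a ∈ C k l) (ha' : a ∉ C k (l - 1))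
      (hb : b = (moveRight k l)^[t] a) (hfree : IsFreeAt l b i)
      (hrest : HasRigging k (b.filter (fun j => j < i)) Λ) :
      HasRigging k a
        ((l, (i * (b i : ℤ) + (i + 1) * (b (i + 1) : ℤ) - (t : ℤ))
            - (Λ.map fun p => (A k l p.1 : ℤ)).sum) :: Λ)

/-- The configuration `a[j₁]`: a particle of weight `l` is put at the column `j₁`. -/
noncomputable def put (l : ℕ) (a : Config) (j₁ : ℤ) : Config := a.update j₁ l

/-- The graph of `P_l`: for all sufficiently large `j₁` and, given `j₁`, all sufficiently
large `t`, the configuration `M_-^t a[j₁]` consists of a particle of weight `l` in the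
columns `j₂, j₂ + 1` for some `j₂`, of nothing to the left of it, and of `a'`, which is
supported to the right of it. -/
def Passes (k l : ℕ) (a a' : Config) : Prop :=
  ∀ᶠ j₁ : ℤ in Filter.atTop, put l a j₁ ∈ C k l ∧
    ∀ᶠ t : ℕ in Filter.atTop, ∃ (j₂ : ℤ) (c : ℕ), 1 ≤ c ∧ c ≤ l ∧
      (∀ i ≤ j₂ + 1, a' i = 0) ∧
      (∀ i < j₂, (moveLeft k l)^[t] (put l a j₁) i = 0) ∧
      (moveLeft k l)^[t] (put l a j₁) j₂ = c ∧
      (moveLeft k l)^[t] (put l a j₁) (j₂ + 1) = l - c ∧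
      (∀ i > j₂ + 1, (moveLeft k l)^[t] (put l a j₁) i = a' i)

end K3

namespace K3

/-! Write x for the configuration and put d = k - l. While the heavy particle travels to the left,
each unit that it meets is displaced to the right by two or by three columns. If u_i units of column
i are displaced by two, then u is determined from right to left by u_i = min(x_i, d - u_{i+1}, k -
x_{i-1} - x_i - x_{i+1}) (`IsSplit`), and P_l a is `splitShift x u`. This is verified by following
the left moves one at a time: `inPassage` is the state with the particle in columns j, j+1, and
`IsSplit.inPassage_spec` shows that j is then the lowest tight position.

With this closed form the riggings can be compared without left moves. For m < l the map preserves
C^{(k,m)} and intertwines the right moves at level m (`IsSplit.exists_hop`), so the times t agree on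
both sides, and the free particle of weight m may first be sent far to the right of the rest. There
min(m, d) of its units are displaced by two and the others by three, so that its energy grows by 2m
+ max(m - d, 0) = A_{l,m}, while the rest undergoes its own passage (`SplitPasses.exists_free`).
Induction on the derivation of the rigging concludes, since the sums of phase shifts depend only on
the particle content.

The map ι is well defined because a free particle moves without changing anything else and gains one
unit of energy per move, so energy minus t does not depend on the stopping time. -/

/-- The recursion satisfied by the part `u i` of the column `i` that a passing particle of weight
`k - d` carries by two columns; the rest of the column is carried by three columns. -/
def IsSplit (k d : ℤ) (x u : ℤ → ℤ) : Prop :=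
  (∃ N, ∀ i, N ≤ i → u i = 0) ∧
    ∀ i, u i = min (x i) (min (d - u (i + 1)) (k - x (i - 1) - x i - x (i + 1)))

/-- The sequence obtained by moving `u i` from the column `i` to the column `i + 2`, and the rest
to the column `i + 3`. -/
def splitShift (x u : ℤ → ℤ) (i : ℤ) : ℤ := u (i - 2) + x (i - 3) - u (i - 3)

/-- The integer version of membership in `C k m`. -/
structure IsAdm (k m : ℤ) (x : ℤ → ℤ) : Prop where
  nonneg : ∀ i, 0 ≤ x i
  three : ∀ i, x i + x (i + 1) + x (i + 2) ≤ k
  two : ∀ i, x i + x (i + 1) ≤ m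
  four : ∀ i, x (i - 1) + 2 * x i + 2 * x (i + 1) + x (i + 2) ≤ k + m

/-- The integer version of membership in `tight`. -/
def TightAt (k m : ℤ) (x : ℤ → ℤ) (i : ℤ) : Prop :=
  x i + x (i + 1) = m ∨ x (i - 1) + 2 * x i + 2 * x (i + 1) + x (i + 2) = k + m

/-! ### The split and its shifted sequence: bounds and admissibility. -/

section Split

variable {k d m : ℤ} {x u : ℤ → ℤ}

theorem IsAdm.three' (h : IsAdm k m x) (i : ℤ) : x (i - 1) + x i + x (i + 1) ≤ k := by
  have := h.three (i - 1)
  rwa [sub_add_cancel, show i - 1 + 2 = i + 1 by ring] at this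

theorem IsSplit.bounds (hu : IsSplit k d x u) (hx : IsAdm k m x) (hd : 0 ≤ d) (i : ℤ) :
    0 ≤ u i ∧ u i ≤ d := by
  obtain ⟨N, hN⟩ := hu.1
  by_cases hi : N ≤ i
  · rw [hN i hi]; exact ⟨le_rfl, hd⟩
  · have key : ∀ j, j ≤ N → 0 ≤ u j ∧ u j ≤ d := by
      intro j hj
      induction j, hj using Int.leInductionDown with
      | base => rw [hN N le_rfl]; exact ⟨le_rfl, hd⟩
      | pred n _ ih =>
        have h1 := hu.2 (n - 1)
        rw [sub_add_cancel] at h1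
        have h2 := hx.nonneg (n - 1)
        have h3 := hx.three' (n - 1)
        rw [sub_add_cancel] at h3
        omega
    exact key i (by omega)

theorem IsSplit.unique {v : ℤ → ℤ} (hu : IsSplit k d x u) (hv : IsSplit k d x v) : u = v := by
  obtain ⟨N, hN⟩ := hu.1
  obtain ⟨M, hM⟩ := hv.1
  have key : ∀ j, j ≤ max N M → u j = v j := by
    intro j hj
    induction j, hj using Int.leInductionDown with
    | base => rw [hN _ (le_max_left _ _), hM _ (le_max_right _ _)]
    | pred n _ ih => rw [hu.2, hv.2, sub_add_cancel, ih]
  funext i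
  by_cases hi : i ≤ max N M
  · exact key i hi
  · rw [hN i (by omega), hM i (by omega)]

theorem IsSplit.le₁ (hu : IsSplit k d x u) (i : ℤ) : u i ≤ x i := by
  have := hu.2 i; omega

theorem IsSplit.le₂ (hu : IsSplit k d x u) (i : ℤ) : u i + u (i + 1) ≤ d := by
  have := hu.2 i; omega

theorem IsSplit.le₃ (hu : IsSplit k d x u) (i : ℤ) :
    u i + x (i - 1) + x i + x (i + 1) ≤ k := by
  have := hu.2 i; omega

theorem IsSplit.cases (hu : IsSplit k d x u) (i : ℤ) :
    u i = x i ∨ u i + u (i + 1) = d ∨ u i + x (i - 1) + x i + x (i + 1) = k := by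
  have := hu.2 i; omega

theorem IsSplit.shift (hu : IsSplit k d x u) (n : ℤ) :
    IsSplit k d (fun i => x (i + n)) (fun i => u (i + n)) := by
  obtain ⟨N, hN⟩ := hu.1
  refine ⟨⟨N - n, fun i hi => hN _ (by omega)⟩, fun i => ?_⟩
  have := hu.2 (i + n)
  rwa [show i + n + 1 = i + 1 + n by ring, show i + n - 1 = i - 1 + n by ring] at this

theorem IsAdm.shift (hx : IsAdm k m x) (n : ℤ) : IsAdm k m (fun i => x (i + n)) := by
  refine ⟨fun i => hx.nonneg _, fun i => ?_, fun i => ?_, fun i => ?_⟩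
  · have := hx.three (i + n)
    rwa [show i + n + 1 = i + 1 + n by ring, show i + n + 2 = i + 2 + n by ring] at this
  · have := hx.two (i + n)
    rwa [show i + n + 1 = i + 1 + n by ring] at this
  · have := hx.four (i + n)
    rwa [show i + n + 1 = i + 1 + n by ring, show i + n + 2 = i + 2 + n by ring,
      show i + n - 1 = i - 1 + n by ring] at this

theorem IsSplit.splitShift_nonneg (hu : IsSplit k d x u) (hx : IsAdm k m x) (hd : 0 ≤ d) (i : ℤ) :
    0 ≤ splitShift x u i := by
  have h1 := (hu.bounds hx hd (i - 2)).1
  have h2 := hu.le₁ (i - 3)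
  unfold splitShift
  omega

theorem IsAdm.lt_of_not_tightAt (hx : IsAdm k m x) {i : ℤ} (h : ¬ TightAt k m x i) :
    x i + x (i + 1) < m ∧ x (i - 1) + 2 * x i + 2 * x (i + 1) + x (i + 2) < k + m := by
  have h1 := hx.two i
  have h2 := hx.four i
  unfold TightAt at h
  omega

/-- Local bounds for the shifted sequence, stated at the column `0`. -/
theorem IsSplit.local_bounds (hu : IsSplit k d x u) (hx : IsAdm k m x) (hd : 0 ≤ d)
    (hmd : m + d < k) :
    splitShift x u 0 + splitShift x u 1 + splitShift x u 2 ≤ k ∧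
    splitShift x u 0 + splitShift x u 1 ≤ m ∧
    splitShift x u (-1) + 2 * splitShift x u 0 + 2 * splitShift x u 1 + splitShift x u 2 ≤ k + m ∧
    (TightAt k m (splitShift x u) 0 → ∃ n, -4 ≤ n ∧ TightAt k m x n) := by
  have hb := hu.bounds hx hd
  have a1 := hu.cases (-3)
  have a2 := hu.cases (-4)
  have a3 := hu.cases (-2)
  have b1 := fun i => (hb i).1
  have c1 := hu.le₁
  have c2 := hu.le₂
  have c3 := hu.le₃
  have e1 := hx.two
  have e2 := hx.four
  have e3 := hx.three
  have e0 := hx.nonneg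
  -- Columns -4 to 0 are those that feed the columns -1 to 2 of the shifted sequence; all
  -- constraints are instantiated there, which leaves a problem of linear arithmetic.
  have p1 := c1 (-4)
  have p2 := c1 (-3)
  have p3 := c1 (-2)
  have p4 := c1 (-1)
  have p5 := c1 0
  have q1 := c2 (-4)
  have q2 := c2 (-3)
  have q3 := c2 (-2)
  have q4 := c2 (-1)
  have r1 := c3 (-4)
  have r2 := c3 (-3)
  have r3 := c3 (-2)
  have r4 := c3 (-1)
  have r5 := c3 0
  have s1 := e1 (-4)
  have s2 := e1 (-3)
  have s3 := e1 (-2)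
  have s4 := e1 (-1)
  have t1 := e2 (-4)
  have t2 := e2 (-3)
  have t3 := e2 (-2)
  have t4 := e2 (-1)
  have v1 := e3 (-4)
  have v2 := e3 (-3)
  have v3 := e3 (-2)
  have v4 := e3 (-1)
  have w1 := e0 (-4)
  have w2 := e0 (-3)
  have w3 := e0 (-2)
  have w4 := e0 (-1)
  have w5 := e0 0
  have y1 := b1 (-4)
  have y2 := b1 (-3)
  have y3 := b1 (-2)
  have y4 := b1 (-1)
  have y5 := b1 0
  have b5 := (hb 0).2
  norm_num at a1 a2 a3 p1 p2 p3 p4 p5 q1 q2 q3 q4 r1 r2 r3 r4 r5 s1 s2 s3 s4 t1 t2 t3 t4 v1 v2 v3 v4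
  norm_num [splitShift]
  refine ⟨?_, ?_, ?_, ?_⟩
  · clear a2 a3; omega
  · clear a2 a3; omega
  · clear a3; omega
  · intro h
    by_contra! hc
    have z0 := hx.lt_of_not_tightAt (hc (-4) (by norm_num))
    have z1 := hx.lt_of_not_tightAt (hc (-3) (by norm_num))
    have z2 := hx.lt_of_not_tightAt (hc (-2) (by norm_num))
    have z3 := hx.lt_of_not_tightAt (hc (-1) (by norm_num))
    norm_num [TightAt, splitShift] at z0 z1 z2 z3 h
    clear hc
    rcases h with h | h
    · clear a2 a3
      omega
    · omega


theorem splitShift_shift (n i : ℤ) :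
    splitShift (fun i => x (i + n)) (fun i => u (i + n)) i = splitShift x u (i + n) := by
  simp only [splitShift, show i - 2 + n = i + n - 2 by ring, show i - 3 + n = i + n - 3 by ring]

theorem tightAt_shift (n i : ℤ) :
    TightAt k m (fun i => x (i + n)) i ↔ TightAt k m x (i + n) := by
  simp only [TightAt, show i + 1 + n = i + n + 1 by ring, show i - 1 + n = i + n - 1 by ring,
    show i + 2 + n = i + n + 2 by ring]

theorem IsSplit.isAdm_splitShift (hu : IsSplit k d x u) (hx : IsAdm k m x) (hd : 0 ≤ d)
    (hmd : m + d < k) : IsAdm k m (splitShift x u) := by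
  have key := fun n => (hu.shift n).local_bounds (hx.shift n) hd hmd
  simp only [splitShift_shift, zero_add] at key
  refine ⟨hu.splitShift_nonneg hx hd, fun i => ?_, fun i => ?_, fun i => ?_⟩
  · simpa only [add_comm] using (key i).1
  · simpa only [add_comm] using (key i).2.1
  · have := (key i).2.2.1
    rwa [show -1 + i = i - 1 by ring, add_comm 1 i, add_comm 2 i] at this

/-- Bounds the advance of the highest tight position by 4, so that after a hop at column 0 only
finitely many columns need inspection. -/
theorem IsSplit.exists_tightAt (hu : IsSplit k d x u) (hx : IsAdm k m x) (hd : 0 ≤ d)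
    (hmd : m + d < k) {i : ℤ} (h : TightAt k m (splitShift x u) i) :
    ∃ n, i - 4 ≤ n ∧ TightAt k m x n := by
  have key := ((hu.shift i).local_bounds (hx.shift i) hd hmd).2.2.2
  have e : splitShift (fun j => x (j + i)) (fun j => u (j + i)) =
      fun j => splitShift x u (j + i) := by
    funext j; exact splitShift_shift i j
  rw [e, tightAt_shift, zero_add] at key
  obtain ⟨n, hn, h⟩ := key h
  exact ⟨n + i, by omega, (tightAt_shift i n).1 h⟩

end Split
-- The right move commutes with the passage.
/-- One unit hops from the column `i` to the column `i + 1`. -/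
def hop (i : ℤ) (x : ℤ → ℤ) (j : ℤ) : ℤ :=
  x j - (if j = i then 1 else 0) + (if j = i + 1 then 1 else 0)

section Hop

variable {k d m : ℤ} {x u : ℤ → ℤ}

/-- The three ways in which the split can react to a right move at the column `0`. -/
theorem IsSplit.hop_aux (hu : IsSplit k d x u) (hx : IsAdm k m x) (hd : 0 ≤ d)
    (hmd : m + d < k) (ht : TightAt k m x 0) (hn : ∀ n, 0 < n → ¬ TightAt k m x n) :
    (u 2 + x 1 + x 2 + x 3 < k →
      ((u 1 + u 2 = d ∨ u 1 + x 0 + x 1 + x 2 = k) →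
        u 0 ≠ x 0 ∧ u (-1) = min (x (-1)) (min (d - u 0) (k - x (-2) - x (-1) - (x 0 - 1))) ∧
        TightAt k m (splitShift x u) 3 ∧ ¬ TightAt k m (splitShift x u) 4) ∧
      ((u 1 + u 2 < d ∧ u 1 + x 0 + x 1 + x 2 < k) →
        u 0 - 1 = min (x 0 - 1) (min (d - (u 1 + 1)) (k - x (-1) - (x 0 - 1) - (x 1 + 1))) ∧
        u (-1) = min (x (-1)) (min (d - (u 0 - 1)) (k - x (-2) - x (-1) - (x 0 - 1))) ∧
        TightAt k m (splitShift x u) 2 ∧ ¬ TightAt k m (splitShift x u) 3 ∧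
          ¬ TightAt k m (splitShift x u) 4)) ∧
    (u 2 + x 1 + x 2 + x 3 = k →
      u 1 + u 2 = d ∧ u 1 + x 0 + x 1 + x 2 < k ∧
      u 0 = min (x 0 - 1) (min (d - (u 1 + 1)) (k - x (-1) - (x 0 - 1) - (x 1 + 1))) ∧
      u (-1) = min (x (-1)) (min (d - u 0) (k - x (-2) - x (-1) - (x 0 - 1))) ∧
      TightAt k m (splitShift x u) 4) := by
  have hb := fun i => (hu.bounds hx hd i).1
  have hb' := fun i => (hu.bounds hx hd i).2
  have n1 := hx.lt_of_not_tightAt (hn 1 (by norm_num))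
  have n2 := hx.lt_of_not_tightAt (hn 2 (by norm_num))
  have n3 := hx.lt_of_not_tightAt (hn 3 (by norm_num))
  have a1 := hu.cases (-1)
  have a2 := hu.cases 0
  have a3 := hu.cases 1
  have a4 := hu.cases 2
  have a5 := hu.cases 3
  have a6 := (hu.isAdm_splitShift hx hd hmd).two 4
  have p1 := hu.le₁ (-1)
  have p2 := hu.le₁ 0
  have p3 := hu.le₁ 1
  have p4 := hu.le₁ 2
  have p5 := hu.le₁ 3
  have q1 := hu.le₂ (-1)
  have q2 := hu.le₂ 0
  have q3 := hu.le₂ 1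
  have q4 := hu.le₂ 2
  have q5 := hu.le₂ 3
  have r1 := hu.le₃ (-1)
  have r2 := hu.le₃ 0
  have r3 := hu.le₃ 1
  have r4 := hu.le₃ 2
  have r5 := hu.le₃ 3
  have s1 := hx.two (-2)
  have s2 := hx.two (-1)
  have s3 := hx.two 0
  have t1 := hx.four (-2)
  have t2 := hx.four (-1)
  have t3 := hx.four 0
  have v1 := hx.three (-2)
  have v2 := hx.three (-1)
  have v3 := hx.three 0
  have v4 := hx.three 1
  have v5 := hx.three 2
  have w1 := hx.nonneg (-2)
  have w2 := hx.nonneg (-1)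
  have w3 := hx.nonneg 0
  have w4 := hx.nonneg 1
  have w5 := hx.nonneg 2
  have y1 := hb (-1)
  have y2 := hb 0
  have y3 := hb 1
  have y4 := hb 2
  have y5 := hb 3
  have z1 := hb' (-1)
  have z2 := hb' 0
  have z3 := hb' 1
  have z4 := hb' 2
  have z5 := hb' 3
  clear hb hb' hn hu hx
  norm_num [TightAt, splitShift] at *
  refine ⟨fun c => ⟨fun c1 => ⟨?_, ?_, ?_, ?_⟩, fun c1 c2 => ⟨?_, ?_, ?_, ?_, ?_⟩⟩,
    fun c => ⟨?_, ?_, ?_, ?_, ?_⟩⟩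
  all_goals first | (clear a5 a6; omega) | omega

/-- A sequence that differs from a split of `x` only in the columns `0`, `1`, `2` is a split of
`hop 0 x` if it satisfies the recursion in the columns affected. -/
theorem isSplit_of_update {v : ℤ → ℤ} (hu : IsSplit k d x u)
    (hv : ∀ i, i < 0 → v i = u i) (hv' : ∀ i, 2 < i → v i = u i)
    (h₁ : v (-1) = min (x (-1)) (min (d - v 0) (k - x (-2) - x (-1) - (x 0 - 1))))
    (h₂ : v 0 = min (x 0 - 1) (min (d - v 1) (k - x (-1) - (x 0 - 1) - (x 1 + 1))))
    (h₃ : v 1 = min (x 1 + 1) (min (d - v 2) (k - (x 0 - 1) - (x 1 + 1) - x 2)))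
    (h₄ : v 2 = min (x 2) (min (d - u 3) (k - (x 1 + 1) - x 2 - x 3))) :
    IsSplit k d (hop 0 x) v := by
  obtain ⟨N, hN⟩ := hu.1
  refine ⟨⟨max N 3, fun i hi => by rw [hv' i (by omega), hN i (by omega)]⟩, fun i => ?_⟩
  by_cases hi1 : i = -1
  · subst hi1; simpa [hop] using h₁
  by_cases hi2 : i = 0
  · subst hi2; simpa [hop] using h₂
  by_cases hi3 : i = 1
  · subst hi3; simpa [hop] using h₃
  by_cases hi4 : i = 2
  · subst hi4
    have := hv' 3 (by norm_num)
    norm_num [hop, this]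
    exact h₄
  have e : v i = u i ∧ v (i + 1) = u (i + 1) := by
    by_cases hi : i < 0
    · exact ⟨hv _ hi, hv _ (by omega)⟩
    · exact ⟨hv' _ (by omega), hv' _ (by omega)⟩
  have := hu.2 i
  rw [e.1, e.2, this]
  unfold hop
  split_ifs <;> omega

/-- The values p = 0, 1, 2 are the three possible reactions of the split to a hop; for p = 1 the two
corrections cancel and u is unchanged. -/
theorem splitShift_hop_zero (p : ℤ) :
    splitShift (hop 0 x)
      (fun j => u j + (if j = 1 then 1 else 0) - (if j = p then 1 else 0)) =
      hop (p + 2) (splitShift x u) := by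
  funext j
  simp only [splitShift, hop, zero_add, show j - 2 = 1 ↔ j - 3 = 0 by omega,
    show j - 2 = p ↔ j = p + 2 by omega, show j - 3 = p ↔ j = p + 2 + 1 by omega]
  ring

theorem IsSplit.hop_zero (hu : IsSplit k d x u) (hx : IsAdm k m x) (hd : 0 ≤ d)
    (hmd : m + d < k) (ht : TightAt k m x 0) (hn : ∀ n, 0 < n → ¬ TightAt k m x n) :
    ∃ v j, IsSplit k d (hop 0 x) v ∧ TightAt k m (splitShift x u) j ∧
      (∀ n, j < n → ¬ TightAt k m (splitShift x u) n) ∧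
      splitShift (hop 0 x) v = hop j (splitShift x u) := by
  have hfar : ∀ n, 4 < n → ¬ TightAt k m (splitShift x u) n := by
    intro n h4 h
    obtain ⟨i, hi, h⟩ := hu.exists_tightAt hx hd hmd h
    exact hn i (by omega) h
  have g1 := hu.2 (-1)
  have g2 := hu.2 0
  have g3 := hu.2 1
  have g4 := hu.2 2
  norm_num at g1 g2 g3 g4
  obtain ⟨h, h'⟩ := hu.hop_aux hx hd hmd ht hn
  -- In this case the unit leaving column 0 was carried by three columns and is carried by two from
  -- column 1, so its image stays in column 3. In exchange a unit of column 2 switches from two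
  -- columns to three, which is a hop at column 4.
  by_cases hc : u 2 + x 1 + x 2 + x 3 = k
  · obtain ⟨h1, h2, h3, h4, h5⟩ := h' hc
    refine ⟨fun j => u j + (if j = 1 then 1 else 0) - (if j = 2 then 1 else 0), 4,
      isSplit_of_update hu ?_ ?_ ?_ ?_ ?_ ?_, h5, hfar, ?_⟩
    · intro i hi; rw [if_neg (by omega), if_neg (by omega)]; ring
    · intro i hi; rw [if_neg (by omega), if_neg (by omega)]; ring
    · norm_num; exact h4
    · norm_num; exact h3
    · norm_num; clear h h' g1 g2 g4 h3 h4 h5; omega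
    · norm_num; clear h h' g1 g2 g3 h3 h4 h5; omega
    · exact splitShift_hop_zero 2
  have r := hu.le₃ 2
  norm_num at r
  replace h := h (lt_of_le_of_ne r hc)
  -- Column 1 has no room for another unit carried by two columns: the hopping unit is carried by
  -- three before and after.
  by_cases hc' : u 1 + u 2 = d ∨ u 1 + x 0 + x 1 + x 2 = k
  · obtain ⟨h1, h2, h3, h4⟩ := h.1 hc'
    refine ⟨u, 3, isSplit_of_update hu (fun _ _ => rfl) (fun _ _ => rfl) ?_ ?_ ?_ ?_, h3, ?_, ?_⟩
    · exact h2
    · clear h h' g1 g3 g4 h2 h3 h4; omega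
    · clear h h' g1 g2 g4 h2 h3 h4; omega
    · clear h h' g1 g2 g3 h2 h3 h4; omega
    · intro n hn
      by_cases h : n = 4
      · rwa [h]
      · exact hfar n (by omega)
    · rw [show (3 : ℤ) = 1 + 2 by norm_num, ← splitShift_hop_zero]
      simp only [add_sub_cancel_right]
  -- Column 1 has room: the hopping unit is carried by two columns before and after.
  · obtain ⟨h1, h2, h3, h4, h5⟩ := h.2 (by
      have h1 := hu.le₂ 1
      have h2 := hu.le₃ 1
      norm_num at h1 h2
      clear h h' g1 g2 g3 g4; omega)
    refine ⟨fun j => u j + (if j = 1 then 1 else 0) - (if j = 0 then 1 else 0), 2,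
      isSplit_of_update hu ?_ ?_ ?_ ?_ ?_ ?_, h3, ?_, ?_⟩
    · intro i hi; rw [if_neg (by omega), if_neg (by omega)]; ring
    · intro i hi; rw [if_neg (by omega), if_neg (by omega)]; ring
    · norm_num; exact h2
    · norm_num; exact h1
    · norm_num; clear h h' g1 g2 g4 h1 h2 h3 h4 h5; omega
    · norm_num; clear h h' g1 g2 g3 h1 h2 h3 h4 h5; omega
    · intro n hn
      by_cases h : n = 3
      · rwa [h]
      by_cases h : n = 4
      · rwa [h]
      · exact hfar n (by omega)
    · exact splitShift_hop_zero 0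

/-- The right move at level `m` commutes with the passage of a particle of weight `k - d > m`. -/
theorem IsSplit.exists_hop (hu : IsSplit k d x u) (hx : IsAdm k m x) (hd : 0 ≤ d)
    (hmd : m + d < k) {i : ℤ} (ht : TightAt k m x i) (hn : ∀ n, i < n → ¬ TightAt k m x n) :
    ∃ v j, IsSplit k d (hop i x) v ∧ TightAt k m (splitShift x u) j ∧
      (∀ n, j < n → ¬ TightAt k m (splitShift x u) n) ∧
      splitShift (hop i x) v = hop j (splitShift x u) := by
  obtain ⟨v, j, h1, h2, h3, h4⟩ := (hu.shift i).hop_zero (hx.shift i) hd hmd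
    ((tightAt_shift i 0).2 (by rwa [zero_add]))
    (fun n hpos h => hn (n + i) (by omega) ((tightAt_shift i n).1 h))
  have e : splitShift (fun j => x (j + i)) (fun j => u (j + i)) =
      fun j => splitShift x u (j + i) := by
    funext j; exact splitShift_shift i j
  rw [e] at h2 h3 h4
  have e2 : (fun j => hop 0 (fun j => x (j + i)) (j + -i)) = hop i x := by
    funext j
    simp only [hop, neg_add_cancel_right]
    split_ifs <;> omega
  refine ⟨fun j => v (j + -i), j + i, ?_, (tightAt_shift i j).1 h2, fun n hji h => ?_, ?_⟩
  · have := h1.shift (-i)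
    rwa [e2] at this
  · refine h3 (n - i) (by omega) ((tightAt_shift i _).2 (by rwa [sub_add_cancel]))
  · funext n
    have := congrFun h4 (n + -i)
    rw [← splitShift_shift, e2] at this
    rw [this]
    simp only [hop, neg_add_cancel_right]
    split_ifs <;> omega

end Hop
-- Configurations as integer sequences, and their tight positions.
/-- A configuration as an integer-valued sequence. -/
def toInt (a : Config) (i : ℤ) : ℤ := a i

theorem toInt_injective : Function.Injective toInt := by
  intro a b h
  ext i
  have := congrFun h i
  simpa [toInt] using this

theorem mem_C_iff {k m : ℕ} {a : Config} : a ∈ C k m ↔ IsAdm k m (toInt a) := by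
  constructor
  · rintro ⟨h1, h2, h3⟩
    refine ⟨fun i => by simp [toInt], fun i => ?_, fun i => ?_, fun i => ?_⟩
    · have := h1 i; simp only [toInt]; omega
    · have := h2 i; simp only [toInt, S] at *; omega
    · have := h3 i; simp only [toInt, L] at *; omega
  · intro h
    refine ⟨fun i => ?_, fun i => ?_, fun i => ?_⟩
    · have := h.three i; simp only [toInt] at this; omega
    · have := h.two i; simp only [toInt, S] at *; omega
    · have := h.four i; simp only [toInt, L] at *; omega

theorem mem_tight_iff {k m : ℕ} {a : Config} {i : ℤ} :
    i ∈ tight k m a ↔ TightAt k m (toInt a) i := by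
  simp only [tight, TightAt, Set.mem_ofPred_eq, S, L, toInt]
  omega

theorem C_mono {k l m : ℕ} (h : l ≤ m) : C k l ⊆ C k m := by
  rintro a ⟨h1, h2, h3⟩
  exact ⟨h1, fun i => (h2 i).trans h, fun i => (h3 i).trans (by omega)⟩

theorem zero_mem_C (k l : ℕ) : (0 : Config) ∈ C k l := by
  simp [C, S, L]

theorem filter_mem_C {k l : ℕ} {b : Config} (h : b ∈ C k l) (p : ℤ → Prop) [DecidablePred p] :
    b.filter p ∈ C k l := by
  have hle : ∀ n, b.filter p n ≤ b n := by
    intro n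
    rw [Finsupp.filter_apply]
    split_ifs <;> simp
  refine ⟨fun i => ?_, fun i => ?_, fun i => ?_⟩
  · have := h.1 i
    have := hle i; have := hle (i + 1); have := hle (i + 2)
    omega
  · have := h.2.1 i
    have := hle i; have := hle (i + 1)
    simp only [S] at *
    omega
  · have := h.2.2 i
    have := hle i; have := hle (i + 1); have := hle (i + 2); have := hle (i - 1)
    simp only [L] at *
    omega

theorem exists_bound (a : Config) : ∃ N : ℤ, ∀ i, N ≤ |i| → a i = 0 := by
  obtain ⟨N, hN⟩ := (a.support.image fun i : ℤ => |i|).bddAbove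
  refine ⟨N + 1, fun i hi => ?_⟩
  by_contra h
  have := hN (Finset.mem_coe.2 (Finset.mem_image_of_mem _ (Finsupp.mem_support_iff.2 h)))
  omega

theorem exists_tight {k m : ℕ} {a : Config} (ha : a ∈ C k m) (ha' : a ∉ C k (m - 1)) :
    (tight k m a).Nonempty := by
  by_contra h
  rw [Set.not_nonempty_iff_eq_empty] at h
  refine ha' ⟨ha.1, fun i => ?_, fun i => ?_⟩ <;>
  · have h1 := ha.2.1 i
    have h2 := ha.2.2 i
    have h3 : i ∉ tight k m a := by rw [h]; exact Set.notMem_empty i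
    simp only [tight, Set.mem_ofPred_eq] at h3
    omega

theorem not_mem_C_of_tight {k m : ℕ} (hm : 1 ≤ m) {a : Config} {i : ℤ} (h : i ∈ tight k m a) :
    a ∉ C k (m - 1) := by
  rintro ⟨_, h2, h3⟩
  have h2 := h2 i
  have h3 := h3 i
  simp only [tight, Set.mem_ofPred_eq] at h
  omega

theorem exists_isGreatest_tight {k m : ℕ} (hm : 1 ≤ m) {a : Config}
    (h : (tight k m a).Nonempty) : ∃ i, IsGreatest (tight k m a) i := by
  obtain ⟨N, hN⟩ := exists_bound a
  have hle : ∀ z, z ∈ tight k m a → z ≤ N + 1 := by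
    intro z hz
    by_contra hlt
    have h0 : ∀ j, z - 1 ≤ j → a j = 0 := fun j hj => hN j (le_trans (by omega) (le_abs_self j))
    simp only [tight, Set.mem_ofPred_eq, S, L, h0 z (by omega), h0 (z + 1) (by omega),
      h0 (z + 2) (by omega), h0 (z - 1) (by omega)] at hz
    omega
  obtain ⟨i, hi, hi'⟩ := Int.exists_greatest_of_bdd ⟨N + 1, hle⟩ h
  exact ⟨i, hi, fun j hj => hi' j hj⟩

/-! ### Right moves and free particles. -/

section Move

variable {k m : ℤ} {x : ℤ → ℤ}

/-- The sums S and L at column 0 do not change, so the position stays tight. The bounds that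
increase lie to the right, where strictness at columns 1 and 2 leaves the necessary room. -/
theorem IsAdm.hop_zero (hx : IsAdm k m x) (ht : TightAt k m x 0)
    (hn : ∀ n, 0 < n → ¬ TightAt k m x n) :
    1 ≤ x 0 ∧ IsAdm k m (hop 0 x) ∧ TightAt k m (hop 0 x) 0 := by
  have n1 := hx.lt_of_not_tightAt (hn 1 (by norm_num))
  have n2 := hx.lt_of_not_tightAt (hn 2 (by norm_num))
  have v1 := hx.three (-1)
  have v2 := hx.three 0
  have v3 := hx.three 1
  have w := hx.nonneg 0
  have w' := hx.nonneg 2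
  have w1 := hx.nonneg 1
  norm_num [TightAt] at ht n1 n2 v1 v2 v3
  have h0 : 1 ≤ x 0 := by omega
  refine ⟨h0, ⟨fun j => ?_, fun j => ?_, fun j => ?_, fun j => ?_⟩, ?_⟩
  · have := hx.nonneg j
    unfold hop
    split_ifs with h1 h2 h2
    · omega
    · subst h1; omega
    · omega
    · omega
  · by_cases h1 : j = 1
    · subst h1; norm_num [hop]; omega
    · have := hx.three j
      unfold hop
      split_ifs <;> omega
  · by_cases h1 : j = 1
    · subst h1; norm_num [hop]; omega
    · have := hx.two j
      unfold hop
      split_ifs <;> omega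
  · by_cases h1 : j = 1
    · subst h1; norm_num [hop]; omega
    by_cases h2 : j = 2
    · subst h2; norm_num [hop]; omega
    · have := hx.four j
      unfold hop
      split_ifs <;> omega
  · norm_num [TightAt, hop]
    omega

theorem hop_shift (i : ℤ) : hop 0 (fun j => x (j + i)) = fun j => hop i x (j + i) := by
  funext j
  simp only [hop]
  split_ifs <;> omega

theorem IsAdm.hop (hx : IsAdm k m x) {i : ℤ} (ht : TightAt k m x i)
    (hn : ∀ n, i < n → ¬ TightAt k m x n) :
    1 ≤ x i ∧ IsAdm k m (hop i x) ∧ TightAt k m (K3.hop i x) i := by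
  obtain ⟨h1, h2, h3⟩ := (hx.shift i).hop_zero ((tightAt_shift i 0).2 (by rwa [zero_add]))
    (fun n hpos h => hn (n + i) (by omega) ((tightAt_shift i n).1 h))
  rw [hop_shift] at h2 h3
  rw [tightAt_shift, zero_add] at h3
  refine ⟨by rwa [zero_add] at h1, ?_, h3⟩
  have := h2.shift (-i)
  simpa only [neg_add_cancel_right] using this

end Move

section MoveRight

variable {k m : ℕ} {a : Config} {i : ℤ}

theorem toInt_moveRight_of_pos (hi : IsGreatest (tight k m a) i) (h : 1 ≤ a i) :
    toInt (moveRight k m a) = hop i (toInt a) := by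
  have e : highest k m a = i := hi.csSup_eq
  funext j
  simp only [toInt, moveRight, e, Finsupp.coe_update, hop]
  by_cases h1 : j = i + 1
  · subst h1; simp
  · by_cases h2 : j = i
    · subst h2; simp; omega
    · simp [h1, h2]

theorem moveRight_spec (ha : a ∈ C k m) (hi : IsGreatest (tight k m a) i) :
    1 ≤ a i ∧ toInt (moveRight k m a) = hop i (toInt a) ∧ moveRight k m a ∈ C k m ∧
      i ∈ tight k m (moveRight k m a) := by
  obtain ⟨h1, h2, h3⟩ := (mem_C_iff.1 ha).hop (mem_tight_iff.1 hi.1)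
    (fun n hn h => absurd (hi.2 (mem_tight_iff.2 h)) (not_le.2 hn))
  have h1 : 1 ≤ a i := by simp only [toInt] at h1; omega
  have e := toInt_moveRight_of_pos hi h1
  exact ⟨h1, e, mem_C_iff.2 (e ▸ h2), mem_tight_iff.2 (e ▸ h3)⟩

theorem degree_moveRight (ha : a ∈ C k m) (hm : 1 ≤ m) (ha' : a ∉ C k (m - 1)) :
    (moveRight k m a).degree = a.degree := by
  obtain ⟨i, hi⟩ := exists_isGreatest_tight hm (exists_tight ha ha')
  have e := (moveRight_spec ha hi).2.1
  have : moveRight k m a + Finsupp.single i 1 = a + Finsupp.single (i + 1) 1 := by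
    ext j
    have := congrFun e j
    simp only [toInt, hop] at this
    simp only [Finsupp.add_apply, Finsupp.single_apply, eq_comm (a := i), eq_comm (a := i + 1)]
    split_ifs at * <;> omega
  have := congrArg Finsupp.degree this
  simpa using this

theorem moveRight_mem (ha : a ∈ C k m) (hm : 1 ≤ m) (ha' : a ∉ C k (m - 1)) :
    moveRight k m a ∈ C k m ∧ moveRight k m a ∉ C k (m - 1) := by
  obtain ⟨i, hi⟩ := exists_isGreatest_tight hm (exists_tight ha ha')
  obtain ⟨_, _, h1, h2⟩ := moveRight_spec ha hi
  exact ⟨h1, not_mem_C_of_tight hm h2⟩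

theorem moveRight_iterate_mem (ha : a ∈ C k m) (hm : 1 ≤ m) (ha' : a ∉ C k (m - 1)) (t : ℕ) :
    (moveRight k m)^[t] a ∈ C k m ∧ (moveRight k m)^[t] a ∉ C k (m - 1) ∧
      ((moveRight k m)^[t] a).degree = a.degree := by
  induction t with
  | zero => exact ⟨ha, ha', rfl⟩
  | succ t ih =>
    rw [Function.iterate_succ_apply']
    obtain ⟨h1, h2⟩ := moveRight_mem ih.1 hm ih.2.1
    exact ⟨h1, h2, (degree_moveRight ih.1 hm ih.2.1).trans ih.2.2⟩

/-- Since the highest tight position stays tight after a move, it never decreases. Either it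
advances towards the bound N of the support, or it stays while its column loses a unit; hence the
nested induction on the distance to N and on the content of the column. -/
theorem exists_free (hm : 1 ≤ m) (N : ℤ) (n p : ℕ) (a : Config) (i : ℤ)
    (ha : a ∈ C k m) (hi : IsGreatest (tight k m a) i) (hN : ∀ j, N ≤ j → a j = 0)
    (hn : (N - i).toNat = n) (hp : a i = p) : ∃ t j, IsFreeAt m ((moveRight k m)^[t] a) j := by
  induction n using Nat.strong_induction_on generalizing p a i with
  | _ n ihn =>
  induction p using Nat.strong_induction_on generalizing a i with
  | _ p ihp =>
  -- If nothing lies in columns i+2 and beyond, tightness of L together with the three-column bound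
  -- at i-1 forces S = m, so the particle is already free.
  obtain ⟨h1, h2, h3, h4⟩ := moveRight_spec ha hi
  by_cases hiN : N ≤ i + 2
  · refine ⟨0, i, ?_, by simpa using Nat.one_le_iff_ne_zero.1 h1,
      fun j hj => hN j (by omega)⟩
    have e : a (i + 2) = 0 := hN _ hiN
    have h5 := ha.1 (i - 1)
    have h6 := ha.2.1 i
    rw [sub_add_cancel, show i - 1 + 2 = i + 1 by ring] at h5
    have h7 := hi.1
    simp only [tight, Set.mem_ofPred_eq, S, L, Function.iterate_zero, id_eq] at *
    omega
  · obtain ⟨j, hj⟩ := exists_isGreatest_tight hm ⟨i, h4⟩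
    have hij := hj.2 h4
    have hN' : ∀ j, N ≤ j → moveRight k m a j = 0 := by
      intro j hj
      have e := congrFun h2 j
      simp only [toInt, hop, hN j hj] at e
      split_ifs at e <;> omega
    have key : ∃ t j, IsFreeAt m ((moveRight k m)^[t] (moveRight k m a)) j := by
      rcases hij.eq_or_lt with rfl | hlt
      · have e := congrFun h2 i
        simp only [toInt, hop] at e
        refine ihp (moveRight k m a i) ?_ _ i h3 hj hN' hn rfl
        simp at e
        omega
      · exact ihn (N - j).toNat (by omega) _ _ j h3 hj hN' rfl rfl
    obtain ⟨t, j, h⟩ := key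
    exact ⟨t + 1, j, by rwa [Function.iterate_succ_apply]⟩

theorem IsFreeAt.isGreatest (ha : a ∈ C k m) (h : IsFreeAt m a i) :
    IsGreatest (tight k m a) i := by
  obtain ⟨h1, h2, h3⟩ := h
  refine ⟨Or.inl h1, fun j hj => ?_⟩
  by_contra! hlt
  have h4 := ha.1 i
  have e2 := h3 (i + 2) le_rfl
  have e3 := h3 (i + 3) (by omega)
  have h0 : ∀ j, i + 2 < j → S a j = 0 ∧ L a j ≤ a (i + 2) := by
    intro j hj
    simp only [S, L, h3 j (by omega), h3 (j + 1) (by omega), h3 (j + 2) (by omega),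
      h3 (j - 1) (by omega)]
    simp
  simp only [tight, Set.mem_ofPred_eq] at hj
  simp only [S] at h1
  by_cases c1 : j = i + 1
  · subst c1
    simp only [S, L, show i + 1 + 1 = i + 2 by ring, show i + 1 + 2 = i + 3 by ring,
      add_sub_cancel_right] at hj
    omega
  by_cases c2 : j = i + 2
  · subst c2
    simp only [S, L, show i + 2 + 1 = i + 3 by ring, show i + 2 - 1 = i + 1 by ring,
      h3 (i + 2 + 2) (by omega)] at hj
    omega
  · have := h0 j (by omega)
    omega

/-- The energy of the pair of columns `i`, `i + 1`. -/
def pairEnergy (a : Config) (i : ℤ) : ℤ := i * (a i : ℤ) + (i + 1) * (a (i + 1) : ℤ)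

/-- A free particle advances under right moves, and nothing else changes. -/
theorem IsFreeAt.moveRight (hm : 1 ≤ m) (ha : a ∈ C k m) (h : IsFreeAt m a i) :
    ∃ j, IsFreeAt m (moveRight k m a) j ∧
      (K3.moveRight k m a).filter (fun n => n < j) = a.filter (fun n => n < i) ∧
      pairEnergy (K3.moveRight k m a) j = pairEnergy a i + 1 ∧
      (K3.moveRight k m a j + 1 = a i ∧ j = i ∨
        j = i + 1 ∧ K3.moveRight k m a j = m ∧ K3.moveRight k m a (j + 1) = 0) := by
  obtain ⟨h1, h2, -, -⟩ := moveRight_spec ha (h.isGreatest ha)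
  obtain ⟨f1, f2, f3⟩ := h
  simp only [S] at f1
  have e : ∀ j, j ≠ i → j ≠ i + 1 → K3.moveRight k m a j = a j := by
    intro j c1 c2
    have := congrFun h2 j
    simpa [toInt, hop, c1, c2] using this
  have e0 : (K3.moveRight k m a i : ℤ) = a i - 1 := by
    have := congrFun h2 i
    simpa [toInt, hop] using this
  have e1 : (K3.moveRight k m a (i + 1) : ℤ) = a (i + 1) + 1 := by
    have := congrFun h2 (i + 1)
    simpa [toInt, hop] using this
  have e2 : K3.moveRight k m a (i + 2) = 0 := by
    rw [e _ (by omega) (by omega)]; exact f3 _ le_rfl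
  -- A free particle has a non-zero first column, so its position becomes i+1 when column i is
  -- emptied.
  by_cases hc : a i = 1
  · refine ⟨i + 1, ⟨?_, by omega, fun j hj => ?_⟩, ?_, ?_, Or.inr ⟨rfl, by omega, ?_⟩⟩
    · simp only [S, show i + 1 + 1 = i + 2 by ring, e2]; omega
    · rw [e _ (by omega) (by omega)]; exact f3 _ (by omega)
    · ext j
      simp only [Finsupp.filter_apply]
      split_ifs with c1 c2 c2
      · exact e _ (by omega) (by omega)
      · have : j = i := by omega
        subst this; omega
      · omega
      · rfl
    · simp only [pairEnergy, show i + 1 + 1 = i + 2 by ring, e2, e1, hc]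
      push_cast; ring
    · rw [show i + 1 + 1 = i + 2 by ring, e2]
  · refine ⟨i, ⟨?_, by omega, fun j hj => ?_⟩, ?_, ?_, Or.inl ⟨by omega, rfl⟩⟩
    · simp only [S]; omega
    · rw [e _ (by omega) (by omega)]; exact f3 _ (by omega)
    · ext j
      simp only [Finsupp.filter_apply]
      split_ifs with c1
      · exact e _ (by omega) (by omega)
      · rfl
    · simp only [pairEnergy, e0, e1]; ring

theorem IsFreeAt.iterate (hm : 1 ≤ m) (ha : a ∈ C k m) (h : IsFreeAt m a i) (s : ℕ) :
    ∃ j, IsFreeAt m ((K3.moveRight k m)^[s] a) j ∧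
      ((K3.moveRight k m)^[s] a).filter (fun n => n < j) = a.filter (fun n => n < i) ∧
      pairEnergy ((K3.moveRight k m)^[s] a) j = pairEnergy a i + s := by
  have ha' := not_mem_C_of_tight hm (h.isGreatest ha).1
  induction s with
  | zero => exact ⟨i, h, rfl, by simp⟩
  | succ s ih =>
    obtain ⟨j, h1, h2, h3⟩ := ih
    obtain ⟨n, g1, g2, g3, -⟩ := h1.moveRight hm (moveRight_iterate_mem ha hm ha' s).1
    rw [Function.iterate_succ_apply']
    exact ⟨n, g1, g2.trans h2, by rw [g3, h3]; push_cast; ring⟩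

/-- A free particle reaches the next column. -/
theorem IsFreeAt.exists_succ (hm : 1 ≤ m) (ha : a ∈ C k m) (h : IsFreeAt m a i) :
    ∃ s, ((K3.moveRight k m)^[s] a) (i + 1) = m ∧ ((K3.moveRight k m)^[s] a) (i + 2) = 0 ∧
      IsFreeAt m ((K3.moveRight k m)^[s] a) (i + 1) := by
  induction hp : a i using Nat.strong_induction_on generalizing a with
  | _ p ih =>
  obtain ⟨j, g1, -, -, ⟨g2, rfl⟩ | ⟨rfl, g2, g3⟩⟩ := h.moveRight hm ha
  · obtain ⟨s, hs⟩ := ih _ (by omega)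
      (moveRight_mem ha hm (not_mem_C_of_tight hm (h.isGreatest ha).1)).1 g1 rfl
    exact ⟨s + 1, hs⟩
  · exact ⟨1, g2, by rwa [show i + 2 = i + 1 + 1 by ring], g1⟩

/-- A free particle reaches columns arbitrarily far to the right. -/
theorem IsFreeAt.exists_far (hm : 1 ≤ m) (ha : a ∈ C k m) (h : IsFreeAt m a i) (n : ℕ) :
    ∃ s, ((K3.moveRight k m)^[s] a) (i + 1 + n) = m ∧
      ((K3.moveRight k m)^[s] a) (i + 1 + n + 1) = 0 ∧
      IsFreeAt m ((K3.moveRight k m)^[s] a) (i + 1 + n) := by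
  have ha' := not_mem_C_of_tight hm (h.isGreatest ha).1
  induction n with
  | zero =>
    obtain ⟨s, hs⟩ := h.exists_succ hm ha
    exact ⟨s, by simpa [add_assoc] using hs⟩
  | succ n ih =>
    obtain ⟨s, -, -, hs⟩ := ih
    obtain ⟨s', h1, h2, h3⟩ := hs.exists_succ hm (moveRight_iterate_mem ha hm ha' s).1
    rw [← Function.iterate_add_apply] at h1 h2 h3
    rw [show i + 1 + (n : ℤ) + 2 = i + 1 + (n : ℤ) + 1 + 1 by ring] at h2
    push_cast
    rw [← add_assoc]
    exact ⟨s' + s, h1, h2, h3⟩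

theorem IsFreeAt.unique (ha : a ∈ C k m) {j : ℤ} (h : IsFreeAt m a i) (h' : IsFreeAt m a j) :
    i = j :=
  (h.isGreatest ha).unique (h'.isGreatest ha)

/-- The remaining configuration and the energy minus the number of moves are independent of the
chosen stopping time; this makes the rigging unique. -/
theorem free_iterate_unique (hm : 1 ≤ m) (ha : a ∈ C k m) (ha' : a ∉ C k (m - 1)) {s t : ℕ}
    {j : ℤ} (hs : IsFreeAt m ((moveRight k m)^[s] a) i)
    (ht : IsFreeAt m ((moveRight k m)^[t] a) j) :
    ((moveRight k m)^[t] a).filter (fun n => n < j) =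
        ((moveRight k m)^[s] a).filter (fun n => n < i) ∧
      pairEnergy ((moveRight k m)^[t] a) j - t = pairEnergy ((moveRight k m)^[s] a) i - s := by
  wlog hst : s ≤ t generalizing s t i j
  · have := this ht hs (by omega)
    exact ⟨this.1.symm, this.2.symm⟩
  obtain ⟨n, rfl⟩ := Nat.exists_eq_add_of_le' hst
  obtain ⟨j', h1, h2, h3⟩ := hs.iterate hm (moveRight_iterate_mem ha hm ha' s).1 n
  rw [← Function.iterate_add_apply] at h1 h2 h3
  obtain rfl := ht.unique (moveRight_iterate_mem ha hm ha' (n + s)).1 h1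
  exact ⟨h2, by rw [h3]; push_cast; ring⟩

end MoveRight

/-! ### Existence and uniqueness of the rigging. -/

section Rigging

variable {k : ℕ}

theorem HasRigging.unique {a : Config} {Λ Λ' : List (ℕ × ℤ)} (h : HasRigging k a Λ)
    (h' : HasRigging k a Λ') : Λ = Λ' := by
  induction h generalizing Λ' with
  | zero =>
    cases h' with
    | zero => rfl
    | step l a b t i Λ hl ha ha' => exact absurd (zero_mem_C _ _) ha'
  | step l a b t i Λ hl ha ha' hb hfree hrest ih =>
    cases h' with
    | zero => exact absurd (zero_mem_C _ _) ha'
    | step m a b' s j Λ' hm hc hc' hb' hfree' hrest' =>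
      obtain rfl : l = m := by
        by_contra hne
        rcases Nat.lt_or_gt_of_ne hne with h | h
        · exact hc' (C_mono (by omega) ha)
        · exact ha' (C_mono (by omega) hc)
      subst hb hb'
      obtain ⟨h1, h2⟩ := free_iterate_unique hl ha ha' hfree hfree'
      rw [h1] at hrest'
      obtain rfl := ih hrest'
      simp only [pairEnergy] at h2
      rw [h2]

theorem eq_zero_of_mem_C_zero {a : Config} (ha : a ∈ C k 0) : a = 0 := by
  ext i
  have := ha.2.1 i
  simp only [S] at this
  simp only [Finsupp.coe_zero, Pi.zero_apply]
  omega

theorem exists_hasRigging {m : ℕ} {a : Config} (ha : a ∈ C k m) : ∃ Λ, HasRigging k a Λ := by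
  induction hn : a.degree using Nat.strong_induction_on generalizing a m with
  | _ n ih =>
  classical
  have hex : ∃ l, a ∈ C k l := ⟨m, ha⟩
  by_cases h0 : a = 0
  · exact ⟨[], h0 ▸ .zero⟩
  set l := Nat.find hex with hldef
  have hal : a ∈ C k l := Nat.find_spec hex
  have hl : 1 ≤ l := by
    by_contra hlt
    have : l = 0 := by omega
    rw [this] at hal
    exact h0 (eq_zero_of_mem_C_zero hal)
  have hal' : a ∉ C k (l - 1) := Nat.find_min hex (by omega)
  obtain ⟨i, hi⟩ := exists_isGreatest_tight hl (exists_tight hal hal')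
  obtain ⟨N, hN⟩ := exists_bound a
  obtain ⟨t, j, hfree⟩ := exists_free hl N _ _ a i hal hi
    (fun j hj => hN j (hj.trans (le_abs_self j))) rfl rfl
  obtain ⟨h1, -, h3⟩ := moveRight_iterate_mem hal hl hal' t
  set b := (moveRight k l)^[t] a with hb
  have hlt : (b.filter fun n => n < j).degree < n := by
    -- Right moves preserve the total number of units, and removing a free particle lowers it.
    have h4 := congrArg Finsupp.degree (Finsupp.filter_add_filter_not b fun n => n < j)
    rw [map_add, h3, hn] at h4
    have h5 : (b.filter fun n => ¬ n < j).degree ≠ 0 := by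
      rw [Ne, Finsupp.degree_eq_zero_iff]
      intro h
      have := DFunLike.congr_fun h j
      rw [Finsupp.filter_apply, if_pos (lt_irrefl j)] at this
      exact hfree.2.1 this
    omega
  obtain ⟨Λ, hΛ⟩ := ih _ hlt (filter_mem_C h1 _) rfl
  exact ⟨_, .step l a b t j Λ hl hal hal' hb hfree hΛ⟩

end Rigging
-- The left moves of the heavy particle, column by column.
/-- The configuration, as an integer-valued sequence, when the passing particle of weight `l` is in
the columns `j` and `j + 1`, with `p` in the column `j`. -/
def inPassage (l : ℤ) (x u : ℤ → ℤ) (j p i : ℤ) : ℤ :=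
  if i < j then x i else if i = j then p else if i = j + 1 then l - x (j - 1) + u (j - 1) - p
    else splitShift x u i

/-- The number of units which end up in the column `j` before the passing particle moves on. -/
def fullColumn (l : ℤ) (x u : ℤ → ℤ) (j : ℤ) : ℤ := l - x (j - 1) - x (j - 2) + u (j - 2)

section

variable {k l m : ℤ} {x u : ℤ → ℤ}

/-- The terms of the minimum defining u(-1) decide the outcome. If u(-1) = x(-1), then S is tight at
0; if u(-1) + u(0) = d, then L is tight at 0. If the third term is attained, then u(-2) + u(-1) ≤ d
gives `fullColumn l x u 0` = x 0, so no move takes place at this column. -/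
theorem IsSplit.inPassage_aux (hu : IsSplit k (k - l) x u) (hx : IsAdm k m x) (hml : m < l)
    (hlk : l ≤ k) :
    x 0 ≤ fullColumn l x u 0 ∧ ∀ p, x 0 ≤ p → p < fullColumn l x u 0 →
      TightAt k l (inPassage l x u 0 p) 0 ∧ 1 ≤ inPassage l x u 0 p 1 ∧
      ∀ n, n < 0 → ¬ TightAt k l (inPassage l x u 0 p) n := by
  have hb := fun i => (hu.bounds hx (by omega) i).1
  have a1 := hu.cases (-1)
  have a2 := hu.cases (-2)
  have p1 := hu.le₁ (-1)
  have p2 := hu.le₁ (-2)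
  have p3 := hu.le₁ 0
  have q1 := hu.le₂ (-1)
  have q2 := hu.le₂ (-2)
  have r1 := hu.le₃ (-1)
  have r2 := hu.le₃ (-2)
  have s1 := hx.two (-2)
  have s2 := hx.two (-1)
  have t1 := hx.four (-2)
  have t2 := hx.four (-1)
  have b1 := hb (-1)
  have b2 := hb (-2)
  norm_num at a1 a2 q1 q2 r1 r2 s1 s2 t1 t2
  have h0 : x 0 ≤ fullColumn l x u 0 := by
    norm_num [fullColumn]; omega
  refine ⟨h0, fun p hp hp' => ?_⟩
  norm_num [fullColumn] at hp'
  refine ⟨?_, ?_, fun n hn h => ?_⟩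
  · norm_num [TightAt, inPassage, splitShift]; omega
  · norm_num [inPassage]; omega
  · by_cases h1 : n = -1
    · subst h1; norm_num [TightAt, inPassage] at h; omega
    by_cases h2 : n = -2
    · subst h2; norm_num [TightAt, inPassage] at h; omega
    · have e := hx.two n
      have e' := hx.four n
      simp only [TightAt, inPassage, if_pos hn, if_pos (show n + 1 < 0 by omega),
        if_pos (show n + 2 < 0 by omega), if_pos (show n - 1 < 0 by omega)] at h
      omega

theorem inPassage_shift (j p i : ℤ) :
    inPassage l (fun i => x (i + j)) (fun i => u (i + j)) 0 p i = inPassage l x u j p (i + j) := by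
  simp only [inPassage, splitShift_shift, show i + j < j ↔ i < 0 by omega,
    show i + j = j ↔ i = 0 by omega, show i + j = j + 1 ↔ i = 0 + 1 by omega,
    show 0 - 1 + j = j - 1 by ring]

theorem IsSplit.inPassage_spec (hu : IsSplit k (k - l) x u) (hx : IsAdm k m x) (hml : m < l)
    (hlk : l ≤ k) (j : ℤ) :
    x j ≤ fullColumn l x u j ∧ ∀ p, x j ≤ p → p < fullColumn l x u j →
      TightAt k l (inPassage l x u j p) j ∧ 1 ≤ inPassage l x u j p (j + 1) ∧
      ∀ n, n < j → ¬ TightAt k l (inPassage l x u j p) n := by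
  obtain ⟨h1, h2⟩ := (hu.shift j).inPassage_aux (hx.shift j) hml hlk
  have e : fullColumn l (fun i => x (i + j)) (fun i => u (i + j)) 0 = fullColumn l x u j := by
    simp only [fullColumn, zero_sub, neg_add_eq_sub]
  rw [e] at h1 h2
  rw [zero_add] at h1 h2
  refine ⟨h1, fun p hp hp' => ?_⟩
  obtain ⟨g1, g2, g3⟩ := h2 p hp hp'
  have e2 : inPassage l (fun i => x (i + j)) (fun i => u (i + j)) 0 p =
      fun i => inPassage l x u j p (i + j) := by
    funext i; exact inPassage_shift j p i
  rw [e2] at g1 g2 g3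
  rw [tightAt_shift, zero_add] at g1
  dsimp only at g2
  rw [add_comm 1 j] at g2
  refine ⟨g1, g2, fun n hn h => g3 (n - j) (by omega) ?_⟩
  rw [tightAt_shift, sub_add_cancel]
  exact h

/-- The handover: a full column j is the same state as the particle in columns j-1, j before any
move there. -/
theorem inPassage_fullColumn (j : ℤ) :
    inPassage l x u j (fullColumn l x u j) = inPassage l x u (j - 1) (x (j - 1)) := by
  funext i
  simp only [inPassage]
  by_cases h1 : i < j - 1
  · rw [if_pos h1, if_pos (by omega)]
  by_cases h2 : i = j - 1
  · subst h2; simp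
  by_cases h3 : i = j
  · subst h3
    rw [if_neg (lt_irrefl i), if_pos rfl, if_neg h1, if_neg h2, if_pos (by ring), fullColumn,
      show i - 1 - 1 = i - 2 by ring]
    ring
  by_cases h4 : i = j + 1
  · subst h4
    simp [fullColumn, splitShift, show j + 1 - 2 = j - 1 by ring, show j + 1 - 3 = j - 2 by ring]
    rw [if_neg (by omega), if_neg (by omega)]
    ring
  · rw [if_neg (by omega), if_neg (by omega), if_neg (by omega), if_neg (by omega), if_neg (by omega),
      if_neg (by omega)]

end

section

variable {k l l' : ℕ} {a b : Config} {u : ℤ → ℤ}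

theorem toInt_moveLeft {i : ℤ} (hi : IsLeast (tight k l b) i) (h : 1 ≤ b (i + 1)) (j : ℤ) :
    toInt (moveLeft k l b) j =
      toInt b j + (if j = i then 1 else 0) - (if j = i + 1 then 1 else 0) := by
  have e : lowest k l b = i := hi.csInf_eq
  simp only [toInt, moveLeft, e, Finsupp.coe_update]
  by_cases h1 : j = i + 1
  · subst h1; simp; omega
  · by_cases h2 : j = i
    · subst h2; simp
    · simp [h1, h2]

theorem moveLeft_inPassage (hu : IsSplit k (k - l) (toInt a) u) (ha : a ∈ C k l') (hl : l' < l)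
    (hlk : l ≤ k) {j p : ℤ} (hb : toInt b = inPassage l (toInt a) u j p) (hp : toInt a j ≤ p)
    (hp' : p < fullColumn l (toInt a) u j) :
    toInt (moveLeft k l b) = inPassage l (toInt a) u j (p + 1) := by
  obtain ⟨h1, h2, h3⟩ := (hu.inPassage_spec (mem_C_iff.1 ha) (by exact_mod_cast hl)
    (by exact_mod_cast hlk) j).2 p hp hp'
  rw [← hb] at h1 h2 h3
  have hleast : IsLeast (tight k l b) j := by
    refine ⟨mem_tight_iff.2 h1, fun n hn => ?_⟩
    by_contra! hlt
    exact h3 n hlt (mem_tight_iff.1 hn)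
  funext i
  rw [toInt_moveLeft hleast (by simpa [toInt] using h2), hb]
  unfold inPassage
  split_ifs <;> omega

theorem moveLeft_iterate_fullColumn (hu : IsSplit k (k - l) (toInt a) u) (ha : a ∈ C k l')
    (hl : l' < l) (hlk : l ≤ k) {j : ℤ} (n : ℕ) {p : ℤ}
    (hb : toInt b = inPassage l (toInt a) u j p) (hp : toInt a j ≤ p)
    (hn : p + n = fullColumn l (toInt a) u j) :
    toInt ((moveLeft k l)^[n] b) = inPassage l (toInt a) u j (fullColumn l (toInt a) u j) := by
  induction n generalizing b p with
  | zero => rw [← hn, Function.iterate_zero, id, hb]; simp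
  | succ n ih =>
    push_cast at hn
    rw [Function.iterate_succ_apply]
    exact ih (moveLeft_inPassage hu ha hl hlk hb hp (by omega)) (by omega) (by omega)

theorem exists_iterate_moveLeft (hu : IsSplit k (k - l) (toInt a) u) (ha : a ∈ C k l')
    (hl : l' < l) (hlk : l ≤ k) {j : ℤ} (n : ℕ)
    (hb : toInt b = inPassage l (toInt a) u j (fullColumn l (toInt a) u j)) :
    ∃ t, toInt ((moveLeft k l)^[t] b) =
      inPassage l (toInt a) u (j - n) (fullColumn l (toInt a) u (j - n)) := by
  induction n with
  | zero => exact ⟨0, by simpa using hb⟩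
  | succ n ih =>
    obtain ⟨t, ht⟩ := ih
    rw [inPassage_fullColumn] at ht
    have hle := (hu.inPassage_spec (mem_C_iff.1 ha) (by exact_mod_cast hl)
      (by exact_mod_cast hlk) (j - n - 1)).1
    have h := moveLeft_iterate_fullColumn hu ha hl hlk
      (fullColumn l (toInt a) u (j - n - 1) - toInt a (j - n - 1)).toNat ht le_rfl (by omega)
    rw [← Function.iterate_add_apply] at h
    push_cast
    rw [← sub_sub]
    exact ⟨_, h⟩

/-- To the left of the configuration the passing particle moves freely. -/
theorem moveLeft_iterate_free (hu : IsSplit k (k - l) (toInt a) u) (ha : a ∈ C k l')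
    (hl : l' < l) (hlk : l ≤ k) {j : ℤ} (h0 : ∀ i ≤ j, toInt a i = 0 ∧ u i = 0)
    (hb : toInt b = inPassage l (toInt a) u j (fullColumn l (toInt a) u j)) (t : ℕ) :
    ∃ i p, i ≤ j ∧ 1 ≤ p ∧ p ≤ (l : ℤ) ∧
      toInt ((moveLeft k l)^[t] b) = inPassage l (toInt a) u i p := by
  have hf : ∀ i ≤ j, fullColumn l (toInt a) u i = l := by
    intro i hi
    simp [fullColumn, h0 (i - 1) (by omega), h0 (i - 2) (by omega)]
  induction t with
  | zero => exact ⟨j, l, le_rfl, by omega, le_rfl, by rw [hf j le_rfl] at hb; simpa using hb⟩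
  | succ t ih =>
    obtain ⟨i, p, h1, h2, h3, h4⟩ := ih
    rw [Function.iterate_succ_apply']
    -- When p = l, the same state is read at column i-1 with p = 0, and the next move gives p = 1.
    rcases h3.eq_or_lt with rfl | h3
    · have h5 := h4
      have h6 := inPassage_fullColumn (l := l) (x := toInt a) (u := u) i
      rw [hf i h1] at h6
      rw [h6, (h0 (i - 1) (by omega)).1] at h5
      exact ⟨i - 1, 0 + 1, by omega, by omega, by omega,
        moveLeft_inPassage hu ha hl hlk h5 (h0 (i - 1) (by omega)).1.le
          (by rw [hf _ (by omega)]; omega)⟩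
    · exact ⟨i, p + 1, h1, by omega, by omega,
        moveLeft_inPassage hu ha hl hlk h4 (by rw [(h0 i h1).1]; omega)
          (by rw [hf i h1]; omega)⟩

/-! ### Existence and uniqueness of the passage, and its description by a split. -/

theorem exists_isSplit (ha : a ∈ C k l') (hlk : l ≤ k) :
    ∃ u, IsSplit k (k - l) (toInt a) u := by
  obtain ⟨N, hN⟩ := exists_bound a
  have hx := mem_C_iff.1 ha
  set x := toInt a with hxa
  have hN : ∀ i, N ≤ i → x i = 0 := fun i hi => by
    simpa [hxa, toInt] using hN i (hi.trans (le_abs_self i))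
  -- The recursion is solved leftwards from the end of the support: g n is the value of u at column
  -- N - n.
  let g : ℕ → ℤ := fun n => Nat.rec 0 (fun n y => min (x (N - n - 1))
    (min (k - l - y) (k - x (N - n - 1 - 1) - x (N - n - 1) - x (N - n - 1 + 1)))) n
  refine ⟨fun i => if N ≤ i then 0 else g (N - i).toNat, ⟨N, fun i hi => if_pos hi⟩, fun i => ?_⟩
  by_cases hi : N ≤ i
  · have h1 := hx.three' i
    have h2 := hN i hi
    simp only [if_pos hi, if_pos (show N ≤ i + 1 by omega)]
    omega
  · obtain ⟨n, hn⟩ : ∃ n : ℕ, N - i = n + 1 := ⟨(N - i - 1).toNat, by omega⟩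
    have e : (N - i).toNat = n + 1 := by omega
    have e2 : N - n - 1 = i := by omega
    have e3 : (if N ≤ i + 1 then 0 else g (N - (i + 1)).toNat) = g n := by
      split_ifs with h
      · have : n = 0 := by omega
        subst this; rfl
      · congr 1; omega
    simp only [if_neg hi, e, e3]
    change min (x (N - n - 1)) (min (k - l - g n)
      (k - x (N - n - 1 - 1) - x (N - n - 1) - x (N - n - 1 + 1))) = _
    rw [e2]

/-- The configuration with the columns `x`, provided these are non-negative and finitely many are
non-zero. -/
theorem exists_toInt_eq {x : ℤ → ℤ} (h0 : ∀ i, 0 ≤ x i) (N : ℤ) (hN : ∀ i, N ≤ |i| → x i = 0) :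
    ∃ a : Config, toInt a = x := by
  have hfin : (Function.support fun i => (x i).toNat).Finite := by
    refine (Set.finite_Icc (-N) N).subset fun i hi => ?_
    have h : x i ≠ 0 := by
      intro h
      simp [h] at hi
    have : |i| < N := lt_of_not_ge fun hle => h (hN i hle)
    rw [abs_lt] at this
    exact ⟨this.1.le, this.2.le⟩
  refine ⟨Finsupp.ofSupportFinite _ hfin, ?_⟩
  funext i
  simp [toInt, Finsupp.ofSupportFinite_coe, h0 i]

/-- `a'` arises from `a` by the passage of a particle of weight `l`, described by a split. -/
def SplitPasses (k l : ℕ) (a a' : Config) : Prop :=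
  ∃ u, IsSplit k (k - l) (toInt a) u ∧ toInt a' = splitShift (toInt a) u

theorem exists_splitPasses (ha : a ∈ C k l') (hlk : l ≤ k) : ∃ a', SplitPasses k l a a' := by
  obtain ⟨u, hu⟩ := exists_isSplit ha hlk
  obtain ⟨N, hN⟩ := exists_bound a
  have hx := mem_C_iff.1 ha
  obtain ⟨a', ha'⟩ := exists_toInt_eq (hu.splitShift_nonneg hx (by omega)) (N + 3) (fun i hi => by
    have h1 : toInt a (i - 2) = 0 := by
      have := hN (i - 2) (by have := abs_sub_abs_le_abs_sub i 2; norm_num at this; omega)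
      simpa [toInt] using this
    have h2 : toInt a (i - 3) = 0 := by
      have := hN (i - 3) (by have := abs_sub_abs_le_abs_sub i 3; norm_num at this; omega)
      simpa [toInt] using this
    have h3 := hu.le₁ (i - 2)
    have h4 := hu.le₁ (i - 3)
    have h5 := (hu.bounds hx (by omega) (i - 2)).1
    have h6 := (hu.bounds hx (by omega) (i - 3)).1
    unfold splitShift
    omega)
  exact ⟨a', u, hu, ha'⟩

theorem SplitPasses.passes {a' : Config} (h : SplitPasses k l a a') (ha : a ∈ C k l')
    (hl : l' < l) (hlk : l ≤ k) : Passes k l a a' := by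
  obtain ⟨u, hu, h⟩ := h
  obtain ⟨N, hN⟩ := exists_bound a
  have hx := mem_C_iff.1 ha
  have hN' : ∀ i, N ≤ |i| → toInt a i = 0 ∧ u i = 0 := by
    intro i hi
    have h1 : toInt a i = 0 := by simpa [toInt] using hN i hi
    have h2 := hu.le₁ i
    have h3 := (hu.bounds hx (by omega) i).1
    exact ⟨h1, by omega⟩
  filter_upwards [Filter.eventually_ge_atTop (|N| + 5)] with j₁ hj₁
  have hN0 := le_abs_self N
  have hN1 := abs_nonneg N
  have hR : ∀ i, j₁ - 5 ≤ i → toInt a i = 0 ∧ u i = 0 :=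
    fun i hi => hN' i (le_trans (by omega) (le_abs_self i))
  have hput : toInt (put l a j₁) = inPassage l (toInt a) u j₁ (fullColumn l (toInt a) u j₁) := by
    funext i
    have e : fullColumn l (toInt a) u j₁ = l := by
      simp [fullColumn, hR (j₁ - 1) (by omega), hR (j₁ - 2) (by omega)]
    rw [e]
    simp only [toInt, put, Finsupp.coe_update, inPassage]
    by_cases h1 : i = j₁
    · subst h1; simp
    rw [Function.update_of_ne h1, if_neg h1]
    have h4 := hR (j₁ - 1) (by omega)
    by_cases h2 : i < j₁
    · rw [if_pos h2]
    have h3 := (hR i (by omega)).1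
    simp only [toInt] at h3 h4
    rw [if_neg h2, h3, splitShift, toInt]
    split_ifs
    · omega
    · have h5 := hR (i - 2) (by omega)
      have h6 := hR (i - 3) (by omega)
      simp only [toInt] at h5 h6
      omega
  refine ⟨?_, ?_⟩
  · have hp : ∀ i, put l a j₁ i = if i = j₁ then l else a i := by
      intro i
      simp only [put, Finsupp.coe_update, Function.update_apply]
    have hz : ∀ i, j₁ - 5 ≤ i → a i = 0 := fun i hi => by
      have := (hR i hi).1
      simpa [toInt] using this
    refine ⟨fun i => ?_, fun i => ?_, fun i => ?_⟩
    · have := ha.1 i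
      have := hz i; have := hz (i + 1); have := hz (i + 2)
      simp only [hp]
      split_ifs <;> omega
    · have := ha.2.1 i
      have := hz i; have := hz (i + 1)
      simp only [S, hp] at *
      split_ifs <;> omega
    · have := ha.2.2 i
      have := hz (i - 1); have := hz i; have := hz (i + 1); have := hz (i + 2)
      simp only [L, hp] at *
      split_ifs <;> omega
  have hL : ∀ i, i ≤ -|N| → toInt a i = 0 ∧ u i = 0 := fun i hi => hN' i (by
    have := neg_le_abs i; omega)
  obtain ⟨t₀, ht₀⟩ := exists_iterate_moveLeft hu ha hl hlk (j₁ + |N| + 5).toNat hput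
  rw [show j₁ - ((j₁ + |N| + 5).toNat : ℤ) = -|N| - 5 by omega] at ht₀
  filter_upwards [Filter.eventually_ge_atTop t₀] with t ht
  obtain ⟨s, rfl⟩ := Nat.exists_eq_add_of_le' ht
  obtain ⟨i, p, h1, h2, h3, h4⟩ := moveLeft_iterate_free hu ha hl hlk
    (fun i hi => hL i (by omega)) ht₀ s
  rw [← Function.iterate_add_apply] at h4
  have hv : ∀ n, (((moveLeft k l)^[s + t₀] (put l a j₁)) n : ℤ) =
      inPassage l (toInt a) u i p n := fun n => congrFun h4 n
  have ha'v : ∀ n, (a' n : ℤ) = splitShift (toInt a) u n := fun n => congrFun h n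
  refine ⟨i, p.toNat, by omega, by omega, fun n hn => ?_, fun n hn => ?_, ?_, ?_, fun n hn => ?_⟩
  · have := ha'v n
    have e1 := hL (n - 2) (by omega)
    have e2 := hL (n - 3) (by omega)
    simp only [splitShift] at this
    omega
  · have := hv n
    have e1 := hL n (by omega)
    rw [inPassage, if_pos hn] at this
    omega
  · have := hv i
    simp only [inPassage, lt_irrefl, if_false, if_true] at this
    omega
  · have := hv (i + 1)
    have e1 := hL (i - 1) (by omega)
    rw [inPassage, if_neg (by omega), if_neg (by omega), if_pos rfl] at this
    omega
  · have := hv n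
    rw [inPassage, if_neg (by omega), if_neg (by omega), if_neg (by omega), ← ha'v] at this
    exact_mod_cast this

/-- Both descriptions hold for a common j₁ and t. As c ≥ 1, the column j₂ is the first non-zero one,
hence the same for both. -/
theorem Passes.unique {a₁ a₂ : Config} (h₁ : Passes k l a a₁) (h₂ : Passes k l a a₂) :
    a₁ = a₂ := by
  obtain ⟨j₁, ⟨-, h₁⟩, -, h₂⟩ := (Filter.Eventually.and h₁ h₂).exists
  obtain ⟨t, ⟨i, c, hc, -, z, e0, e1, e2, e3⟩, ⟨i', c', hc', -, z', f0, f1, f2, f3⟩⟩ :=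
    (h₁.and h₂).exists
  obtain rfl : i = i' := by
    rcases lt_trichotomy i i' with h | h | h
    · have := f0 i h; omega
    · exact h
    · have := e0 i' h; omega
  ext n
  by_cases hn : n ≤ i + 1
  · rw [z n hn, z' n hn]
  · rw [← e3 n (by omega), f3 n (by omega)]

theorem passes_iff_splitPasses {a' : Config} (ha : a ∈ C k l') (hl : l' < l) (hlk : l ≤ k) :
    Passes k l a a' ↔ SplitPasses k l a a' := by
  refine ⟨fun h => ?_, fun h => h.passes ha hl hlk⟩
  obtain ⟨b, hb⟩ := exists_splitPasses ha hlk
  rwa [h.unique (hb.passes ha hl hlk)]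

end
-- Effect of the passage on particle content and rigging.
section

variable {k l m : ℕ} {a a' : Config}

theorem SplitPasses.mem_C (h : SplitPasses k l a a') (ha : a ∈ C k m) (hml : m < l)
    (hlk : l ≤ k) : a' ∈ C k m := by
  obtain ⟨u, hu, e⟩ := h
  rw [mem_C_iff, e]
  exact hu.isAdm_splitShift (mem_C_iff.1 ha) (by omega) (by omega)

/-- The passage of a heavier particle commutes with the right move, and preserves the maximal
weight. -/
theorem SplitPasses.moveRight (h : SplitPasses k l a a') (ha : a ∈ C k m) (hm : 1 ≤ m)
    (ha' : a ∉ C k (m - 1)) (hml : m < l) (hlk : l ≤ k) :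
    a' ∉ C k (m - 1) ∧ SplitPasses k l (K3.moveRight k m a) (K3.moveRight k m a') := by
  have hC := h.mem_C ha hml hlk
  obtain ⟨u, hu, e⟩ := h
  obtain ⟨i, hi⟩ := exists_isGreatest_tight hm (exists_tight ha ha')
  obtain ⟨v, j, h1, h2, h3, h4⟩ := hu.exists_hop (mem_C_iff.1 ha) (by omega) (by omega)
    (mem_tight_iff.1 hi.1) (fun n hn h => absurd (hi.2 (mem_tight_iff.2 h)) (not_le.2 hn))
  rw [← e] at h2 h3 h4
  have hj : IsGreatest (tight k m a') j := by
    refine ⟨mem_tight_iff.2 h2, fun n hn => ?_⟩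
    by_contra! hlt
    exact h3 n hlt (mem_tight_iff.1 hn)
  have e1 := (moveRight_spec ha hi).2.1
  have e2 := (moveRight_spec hC hj).2.1
  rw [← e1] at h1 h4
  exact ⟨not_mem_C_of_tight hm hj.1, v, h1, by rw [e2, h4]⟩

theorem SplitPasses.iterate_moveRight (h : SplitPasses k l a a') (ha : a ∈ C k m) (hm : 1 ≤ m)
    (ha' : a ∉ C k (m - 1)) (hml : m < l) (hlk : l ≤ k) (t : ℕ) :
    SplitPasses k l ((K3.moveRight k m)^[t] a) ((K3.moveRight k m)^[t] a') := by
  induction t with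
  | zero => exact h
  | succ t ih =>
    obtain ⟨h1, h2, -⟩ := moveRight_iterate_mem ha hm ha' t
    rw [Function.iterate_succ_apply', Function.iterate_succ_apply']
    exact (ih.moveRight h1 hm h2 hml hlk).2

/-- The split of a configuration with a particle of weight `m` far to the right. -/
theorem IsSplit.add_far {k d m : ℤ} {y v : ℤ → ℤ} (hv : IsSplit k d y v) (hd : 0 ≤ d)
    (hm : 1 ≤ m) (hmd : m + d < k) {n : ℤ} (hy : ∀ i, n - 3 ≤ i → y i = 0 ∧ v i = 0) :
    IsSplit k d (fun i => y i + if i = n then m else 0)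
      (fun i => v i + if i = n then min m d else 0) := by
  obtain ⟨N, hN⟩ := hv.1
  refine ⟨⟨max N (n + 1), fun i hi => ?_⟩, fun i => ?_⟩
  · dsimp only
    rw [hN i (by omega), if_neg (by omega), add_zero]
  · have h0 := hv.2 i
    have h1 := hy (i - 1)
    have h2 := hy i
    have h3 := hy (i + 1)
    simp only
    split_ifs <;> omega

/-- A configuration with a free particle of weight `m` far to the right is transformed into one
with a free particle, whose energy is larger by `A k l m`. -/
theorem SplitPasses.exists_free (h : SplitPasses k l a a') (ha : a ∈ C k m) (hm : 1 ≤ m)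
    (hml : m < l) (hlk : l ≤ k) {n : ℤ} (hn : a n = m) (hn' : ∀ i, n < i → a i = 0)
    (hfar : ∀ i, n - 3 ≤ i → i < n → a i = 0) :
    ∃ j, IsFreeAt m a' j ∧ pairEnergy a' j = pairEnergy a n + A k l m ∧
      SplitPasses k l (a.filter fun i => i < n) (a'.filter fun i => i < j) := by
  obtain ⟨u, hu, e⟩ := h
  have hb : (a.filter fun i => i < n) ∈ C k m := filter_mem_C ha _
  obtain ⟨v, hv⟩ := exists_isSplit hb hlk
  set y := toInt (a.filter fun i => i < n) with hydef
  have hyv : ∀ i, y i = if i < n then (a i : ℤ) else 0 := by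
    intro i
    simp only [hydef, toInt, Finsupp.filter_apply]
    split_ifs <;> simp
  have hy : ∀ i, n - 3 ≤ i → y i = 0 ∧ v i = 0 := by
    intro i hi
    have h1 : y i = 0 := by
      rw [hyv]
      split_ifs with hlt
      · rw [hfar i hi hlt]; rfl
      · rfl
    have h2 := hv.le₁ i
    have h3 := (hv.bounds (mem_C_iff.1 hb) (by omega) i).1
    exact ⟨h1, by omega⟩
  have hx : toInt a = fun i => y i + if i = n then (m : ℤ) else 0 := by
    funext i
    simp only [hyv, toInt]
    rcases lt_trichotomy i n with h | h | h
    · rw [if_pos h, if_neg h.ne, add_zero]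
    · subst h; simp [hn]
    · rw [if_neg (by omega), if_neg (by omega), hn' i h]; rfl
  have hu' := hv.add_far (m := m) (by omega) (by omega) (by omega) hy
  rw [← hx] at hu'
  -- By uniqueness, the split of `a` is that of the remaining configuration plus min(m, k - l) in
  -- column n.
  obtain rfl := hu.unique hu'
  have hs : ∀ i, (a' i : ℤ) = splitShift y v i + (if i = n + 2 then min (m : ℤ) (k - l) else 0)
      + if i = n + 3 then m - min (m : ℤ) (k - l) else 0 := by
    intro i
    have := congrFun e i
    rw [hx] at this
    simp only [splitShift, toInt, show i - 2 = n ↔ i = n + 2 by omega,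
      show i - 3 = n ↔ i = n + 3 by omega] at this
    rw [this]
    simp only [splitShift]
    split_ifs <;> ring
  have hs0 : ∀ i, n ≤ i → splitShift y v i = 0 := by
    intro i hi
    have h1 := hy (i - 2) (by omega)
    have h2 := hy (i - 3) (by omega)
    simp only [splitShift]
    omega
  have s2 := hs (n + 2)
  have s3 := hs (n + 3)
  have sfar : ∀ i, n + 4 ≤ i → a' i = 0 := by
    intro i hi
    have := hs i
    rw [hs0 i (by omega), if_neg (by omega), if_neg (by omega)] at this
    omega
  rw [hs0 _ (by omega), if_pos rfl, if_neg (by omega)] at s2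
  rw [hs0 _ (by omega), if_neg (by omega), if_pos rfl] at s3
  have s4 := sfar (n + 4) le_rfl
  have hn1 := hn' (n + 1) (by omega)
  have hA : (A k l m : ℤ) = 2 * m + (m - min (m : ℤ) (k - l)) := by
    simp only [A]; omega
  have hE : pairEnergy a n = n * m := by
    rw [pairEnergy, hn1, hn]; push_cast; ring
  -- For k = l no unit is displaced by two columns, so the image lies entirely in column n+3, which
  -- is then its position; otherwise column n+2 is non-zero and the position is n+2.
  by_cases hkl : k = l
  · subst hkl
    refine ⟨n + 3, ⟨?_, by omega, fun j hj => sfar j (by omega)⟩, ?_, v, hv, ?_⟩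
    · simp only [S, show n + 3 + 1 = n + 4 by ring]; omega
    · rw [hE, hA, pairEnergy, show n + 3 + 1 = n + 4 by ring, s4, s3, sub_self,
        min_eq_right (by omega)]
      push_cast; ring
    · funext i
      simp only [toInt, Finsupp.filter_apply]
      split_ifs with hi
      · rw [hs, sub_self, min_eq_right (by omega), if_neg (show ¬ i = n + 3 by omega)]
        split_ifs <;> ring
      · rw [hs0 i (by omega)]; rfl
  · refine ⟨n + 2, ⟨?_, by omega, fun j hj => sfar j (by omega)⟩, ?_, v, hv, ?_⟩
    · simp only [S, show n + 2 + 1 = n + 3 by ring]; omega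
    · rw [hE, hA, pairEnergy, show n + 2 + 1 = n + 3 by ring, s3, s2]
      ring
    · funext i
      simp only [toInt, Finsupp.filter_apply]
      split_ifs with hi
      · rw [hs, if_neg (by omega), if_neg (by omega)]; ring
      · rw [hs0 i (by omega)]; rfl

/-- The passage of a heavier particle preserves the particle content and shifts the rigging. -/
theorem HasRigging.splitPasses {l' : ℕ} {Λ : List (ℕ × ℤ)} (hΛ : HasRigging k a Λ)
    (h : SplitPasses k l a a') (ha : a ∈ C k l') (hl : l' < l) (hlk : l ≤ k) :
    HasRigging k a' (Λ.map fun p => (p.1, p.2 + (A k l p.1 : ℤ))) := by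
  induction hΛ generalizing a' with
  | zero =>
    have h0 := h.mem_C (zero_mem_C k 0) (by omega) hlk
    rw [eq_zero_of_mem_C_zero h0]
    exact .zero
  | step m a b t i Λ hm hc hc' hb hfree hrest ih =>
    have hml' : m ≤ l' := by
      by_contra hge
      exact hc' (C_mono (by omega) ha)
    have hml : m < l := by omega
    have hbC := (moveRight_iterate_mem hc hm hc' t).1
    rw [← hb] at hbC
    obtain ⟨N, hN⟩ := exists_bound b
    -- The three additional successors put n-3 to the right of i, so the columns from n-3 to n-1 are
    -- empty once the particle has reached n.
    obtain ⟨s, g1, g2, g3⟩ := hfree.exists_far hm hbC (N - i).toNat.succ.succ.succ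
    set n := i + 1 + ((N - i).toNat.succ.succ.succ : ℤ) with hn
    obtain ⟨n', f1, f2, f3⟩ := hfree.iterate hm hbC s
    have hb'C := (moveRight_iterate_mem hbC hm (not_mem_C_of_tight hm (hfree.isGreatest hbC).1) s).1
    obtain rfl := g3.unique hb'C f1
    set b' := (moveRight k m)^[s] b with hb'
    have hb't : b' = (moveRight k m)^[s + t] a := by rw [hb', hb, Function.iterate_add_apply]
    have hfar : ∀ j, n - 3 ≤ j → j < n → b' j = 0 := by
      intro j hj hjn
      have := DFunLike.congr_fun f2 j
      rw [Finsupp.filter_apply, if_pos hjn, Finsupp.filter_apply, if_neg (by omega)] at this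
      exact this
    have hn' : ∀ j, n < j → b' j = 0 := by
      intro j hj
      by_cases h1 : j = n + 1
      · rw [h1]; exact g2
      · exact g3.2.2 j (by omega)
    have hpass := h.iterate_moveRight hc hm hc' hml hlk (s + t)
    rw [← hb't] at hpass
    obtain ⟨j, k1, k2, k3⟩ := hpass.exists_free hb'C hm hml hlk g1 hn' hfar
    rw [f2] at k3
    have hfin := HasRigging.step m a' _ (s + t) j _ hm (h.mem_C hc hml hlk)
      (h.moveRight hc hm hc' hml hlk).1 rfl k1 (ih k3 (C_mono hml' (filter_mem_C hbC _)))
    -- The phase shifts subtracted in the rigging see only the weights, which the passage preserves.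
    have e : (List.map (fun p => (A k m p.1 : ℤ))
        (Λ.map fun p => (p.1, p.2 + (A k l p.1 : ℤ)))).sum =
        (Λ.map fun p => (A k m p.1 : ℤ)).sum := by
      rw [List.map_map]; rfl
    rw [e] at hfin
    simp only [pairEnergy] at k2 f3
    rw [List.map_cons]
    convert hfin using 3
    rw [k2, f3]
    push_cast
    ring

end

end K3

theorem mainTheorem3 (k l l' : ℕ) (hl' : 1 ≤ l') (hl'l : l' < l) (hlk : l ≤ k)
    (a : K3.Config) (ha : a ∈ K3.C k l') :
    (∃! a' : K3.Config, K3.Passes k l a a') ∧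
    (∃! Λ : List (ℕ × ℤ), K3.HasRigging k a Λ) ∧
    ∀ a' : K3.Config, K3.Passes k l a a' →
      a' ∈ K3.C k l' ∧
      ∀ Λ : List (ℕ × ℤ), K3.HasRigging k a Λ →
        ∀ Λ' : List (ℕ × ℤ), K3.HasRigging k a' Λ' ↔
          Λ' = Λ.map fun p => (p.1, p.2 + (K3.A k l p.1 : ℤ)) := by
  refine ⟨?_, ?_, fun a' h => ?_⟩
  · obtain ⟨a', h⟩ := K3.exists_splitPasses ha hlk
    exact ⟨a', h.passes ha hl'l hlk, fun b hb => hb.unique (h.passes ha hl'l hlk)⟩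
  · obtain ⟨Λ, h⟩ := K3.exists_hasRigging ha
    exact ⟨Λ, h, fun Λ' h' => h'.unique h⟩
  · rw [K3.passes_iff_splitPasses ha hl'l hlk] at h
    refine ⟨h.mem_C ha hl'l hlk, fun Λ hΛ Λ' => ?_⟩
    have hmap := hΛ.splitPasses h ha hl'l hlk
    exact ⟨fun h' => h'.unique hmap, fun e => e ▸ hmap⟩
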